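/- For a positive square-free integer $a$ let $\mathcal O_a$ denote the ring of integers of $\mathbb Q(\sqrt{-a})$, with norm $N(x+y\sqrt{-a})=x^2+ay^2$ for $x,y\in\mathbb Q$. Call $a$ a Heegner number if $\mathcal O_a$ is a unique factorization domain. For integers $n\ge 0$ put \[ X(n,a)=\{(x,y)\in\mathbb Z\times\mathbb Z : x^2+ay^2=n\},\qquad Y(n,a)=\{z\in\mathcal O_a : N(z)=n\}. \] The numbers $11, 19, 43, 67, 163$ are Heegner numbers. Moreover, let $a\ge 11$ be a Heegner number and let $n\ge 0$ be an integer. Then $X(n,a)$ and $Y(n,a)$ are finite, and: (a) If $n$ is even, then $|X(n,a)|=|Y(n,a)|$. (b) If $n$ is odd, then \[ |X(n,a)|=\frac13\left[1+2\cdot\frac{(\tau(n_q)\,|\,3)}{\tau(n_q)}\right]\cdot|Y(n,a)|, \] where $n_q$ is the product of all prime factors of $n$ (with multiplicity) that are quadratic residues modulo $a$ but are not of the form $x^2+ay^2$ with $x,y\in\mathbb Z$, $\tau(m)$ is the number of positive divisors of $m$, and $(\,\cdot\,|\,3)$ is the Legendre symbol modulo $3$ (equal to $0$ at multiples of $3$).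 -/

import Mathlib

namespace NormRep

/-- The quadratic algebra `ℚ(√-a) = {x + y√-a : x, y ∈ ℚ}`; the element `⟨x, y⟩` is `x + y√-a`.
It is a field for every `a > 0`. -/
abbrev QSqrt (a : ℕ) : Type := QuadraticAlgebra ℚ (-(a : ℚ)) 0

/-- The ring of integers of `ℚ(√-a)`: the elements that are integral over `ℤ`. -/
abbrev ringOfInt (a : ℕ) : Subalgebra ℤ (QSqrt a) := integralClosure ℤ (QSqrt a)

/-- A Heegner number: a square-free positive integer `a` (`Squarefree 0` is false) such that the
ring of integers of `ℚ(√-a)` is a unique factorization domain. -/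
def IsHeegner (a : ℕ) : Prop :=
  Squarefree a ∧ UniqueFactorizationMonoid (ringOfInt a)

/-- The integral solutions of `x² + a y² = n`. -/
def X (n a : ℕ) : Set (ℤ × ℤ) :=
  {p | p.1 ^ 2 + (a : ℤ) * p.2 ^ 2 = (n : ℤ)}

/-- The elements of norm `n` in the ring of integers of `ℚ(√-a)`, where
`N(x + y√-a) = x² + a y²`. -/
def Y (n a : ℕ) : Set (ringOfInt a) :=
  {z | QuadraticAlgebra.norm (z : QSqrt a) = (n : ℚ)}

/-- `p` is a quadratic residue modulo `a` but not of the form `x² + a y²` with integers `x, y`. -/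
def IsQPrime (a p : ℕ) : Prop :=
  IsSquare (p : ZMod a) ∧ ¬ ∃ x y : ℤ, x ^ 2 + (a : ℤ) * y ^ 2 = (p : ℤ)

open Classical in
/-- The product, with multiplicity, of the prime factors of `n` that are quadratic residues
modulo `a` but not of the form `x² + a y²`. -/
noncomputable def qPart (n a : ℕ) : ℕ :=
  ∏ p ∈ n.primeFactors with IsQPrime a p, p ^ n.factorization p

/-- The number of positive divisors of `m`. -/
def tau (m : ℕ) : ℕ := m.divisors.card

end NormRep

/-! A Heegner number `a ≥ 11` is a prime congruent to 3 modulo 8: any other residue or a proper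
factor would make 2 or a prime divisor of `a` a prime element dividing a norm without dividing the
element (`IsHeegner.mod_eight`, `IsHeegner.prime`). So `a = 4c - 1` with `c` odd, the integers are
`ℤ[ω]` with `ω² = ω - c`, and 2 is inert with residue field `𝔽₄`. The solutions in `X` are the
elements of `ℤ[√-a]`, that is, those with even `ω`-coordinate. An even norm forces divisibility by
2, which gives (a).

For odd norm, `𝔽₄ˣ` has order 3, so reduction modulo 2 gives a cubic character `chi`, equal to 1
exactly on `ℤ[√-a]`. Orthogonality and invariance under conjugation give `3|X| = |Y| + 2S`, where
`S` is the sum of `chi` over the elements of norm `n` (`three_mul_card_even`). By unique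
factorization, with units `±1` of character 1, `S` and `|Y|` are computed prime by prime
(`sum_chi_mul_tau`). Their local factors agree except at split `p` whose generator has a character
value `w ≠ 1`. There `p ^ k` contributes `k + 1` to `|Y|` and `∑ w^i w^(2j)` over `i + j = k` to
`S`, which is the Legendre symbol of `k + 1` modulo 3. Those `p` are the primes entering `n_q`
(`isQPrime_iff_of_norm`, `not_isQPrime_of_inert`).

Factoriality enters only as `InertOrNorm`; for the five listed numbers this follows by descent from
finitely many small primes. -/

namespace NormRep

open QuadraticAlgebra

/-- The quadratic order `ℤ[ω]` with `ω² = ω - c`; its discriminant is `-(4c - 1)`. -/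
abbrev QuadOrder (c : ℤ) : Type := QuadraticAlgebra ℤ (-c) 1

/-- Every rational prime stays prime in `QuadOrder c` or is a QuadraticAlgebra.norm from it. -/
def InertOrNorm (c : ℤ) : Prop :=
  ∀ p : ℕ, p.Prime → Prime (p : QuadOrder c) ∨ ∃ z : QuadOrder c, QuadraticAlgebra.norm z = p

/-! ### Primes and unique factorization in `ℤ[ω]` -/

namespace QuadOrder

variable {c : ℤ}

theorem norm_eq (z : QuadOrder c) :
    QuadraticAlgebra.norm z = z.re ^ 2 + z.re * z.im + c * z.im ^ 2 := by
  rw [QuadraticAlgebra.norm_def]; ring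

theorem four_mul_norm (z : QuadOrder c) :
    4 * QuadraticAlgebra.norm z = (2 * z.re + z.im) ^ 2 + (4 * c - 1) * z.im ^ 2 := by
  rw [norm_eq]; ring

theorem norm_nonneg (hc : 0 < c) (z : QuadOrder c) : 0 ≤ QuadraticAlgebra.norm z := by
  nlinarith [four_mul_norm z, sq_nonneg (2 * z.re + z.im), sq_nonneg z.im]

theorem norm_eq_zero (hc : 0 < c) {z : QuadOrder c} : QuadraticAlgebra.norm z = 0 ↔ z = 0 := by
  refine ⟨fun h => ?_, fun h => by simp [h]⟩
  have h4 := four_mul_norm z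
  have him : z.im = 0 := by
    by_contra hne
    have : 0 < z.im ^ 2 := by positivity
    nlinarith [sq_nonneg (2 * z.re + z.im)]
  have hre : z.re = 0 := by
    rw [h, him] at h4
    have : z.re ^ 2 = 0 := by linarith
    exact pow_eq_zero_iff (two_ne_zero) |>.1 this
  ext <;> simp [him, hre]

theorem isDomain (hc : 0 < c) : IsDomain (QuadOrder c) := by
  have : NoZeroDivisors (QuadOrder c) := ⟨fun {x y} h => by
    have h' : QuadraticAlgebra.norm x * QuadraticAlgebra.norm y = 0 := by
      rw [← map_mul, h, QuadraticAlgebra.norm_zero]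
    rcases mul_eq_zero.1 h' with h' | h'
    · exact Or.inl ((norm_eq_zero hc).1 h')
    · exact Or.inr ((norm_eq_zero hc).1 h')⟩
  exact NoZeroDivisors.to_isDomain _

theorem isUnit_iff (hc : 0 < c) {z : QuadOrder c} : IsUnit z ↔ QuadraticAlgebra.norm z = 1 := by
  rw [isUnit_iff_norm_isUnit, Int.isUnit_iff]
  have := norm_nonneg hc z
  omega

/-- The bound excludes the Eisenstein case `c = 1` with its six units: `4c - 1 > 4` forces `z.im =
0`. -/
theorem norm_eq_one_iff (hc : 2 ≤ c) {z : QuadOrder c} :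
    QuadraticAlgebra.norm z = 1 ↔ z = 1 ∨ z = -1 := by
  refine ⟨fun h => ?_, by rintro (rfl | rfl) <;> simp⟩
  have h4 := four_mul_norm z
  have him : z.im = 0 := by
    by_contra hne
    have : 0 < z.im ^ 2 := by positivity
    nlinarith [sq_nonneg (2 * z.re + z.im)]
  have hre : z.re ^ 2 = 1 := by
    rw [h, him] at h4
    linarith
  rcases mul_self_eq_one_iff.1 ((sq _).symm.trans hre) with h | h
  · left; ext <;> simp [him, h]
  · right; ext <;> simp [him, h]

theorem intCast_dvd {n : ℤ} {z : QuadOrder c} : (n : QuadOrder c) ∣ z ↔ n ∣ z.re ∧ n ∣ z.im := by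
  constructor
  · rintro ⟨w, rfl⟩
    exact ⟨⟨w.re, by simp⟩, ⟨w.im, by simp⟩⟩
  · rintro ⟨⟨x, hx⟩, ⟨y, hy⟩⟩
    exact ⟨⟨x, y⟩, by ext <;> simp [hx, hy]⟩

theorem natCast_dvd {n : ℕ} {z : QuadOrder c} :
    (n : QuadOrder c) ∣ z ↔ (n : ℤ) ∣ z.re ∧ (n : ℤ) ∣ z.im := by
  rw [← intCast_dvd]; simp

theorem mul_star_eq (z : QuadOrder c) :
    z * star z = ((QuadraticAlgebra.norm z : ℤ) : QuadOrder c) := by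
  rw [← algebraMap_norm_eq_mul_star]; simp

theorem mul_star_eq_nat {z : QuadOrder c} {n : ℕ} (h : QuadraticAlgebra.norm z = n) :
    z * star z = (n : QuadOrder c) := by
  rw [mul_star_eq, h]; simp

theorem dvd_star_iff {z w : QuadOrder c} : z ∣ star w ↔ star z ∣ w := by
  constructor
  · rintro ⟨v, h⟩
    exact ⟨star v, by rw [← star_star w, h, star_mul, mul_comm]⟩
  · rintro ⟨v, rfl⟩
    exact ⟨star v, by rw [star_mul, star_star, mul_comm]⟩

theorem norm_dvd {z w : QuadOrder c} (h : z ∣ w) :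
    QuadraticAlgebra.norm z ∣ QuadraticAlgebra.norm w := by
  obtain ⟨v, rfl⟩ := h
  simp

/-- An element of prime norm generates a prime ideal, as the quotient is the prime field. -/
theorem prime_of_norm (hc : 0 < c) {p : ℕ} (hp : p.Prime) {z : QuadOrder c}
    (hz : QuadraticAlgebra.norm z = p) : Prime z := by
  have hp' : Prime (p : ℤ) := Nat.prime_iff_prime_int.1 hp
  have hpz : z ∣ (p : QuadOrder c) := ⟨_, (mul_star_eq_nat hz).symm⟩
  have him : ¬ (p : ℤ) ∣ z.im := by
    intro h
    have h1 : (p : ℤ) ∣ z.re ^ 2 := by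
      have : z.re ^ 2 = p - (z.re + c * z.im) * z.im := by rw [← hz, norm_eq]; ring
      rw [this]
      exact dvd_sub dvd_rfl (h.mul_left _)
    obtain ⟨x, hx⟩ := hp'.dvd_of_dvd_pow h1
    obtain ⟨y, hy⟩ := h
    rw [norm_eq, hx, hy] at hz
    have : (p : ℤ) * (x ^ 2 + x * y + c * y ^ 2) = 1 := by
      have := hp'.ne_zero
      apply mul_left_cancel₀ this
      linear_combination hz
    exact hp'.not_isUnit (IsUnit.of_mul_eq_one _ this)
  obtain ⟨s, t, hst⟩ : IsCoprime z.im (p : ℤ) := by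
    rw [isCoprime_comm]
    exact (Prime.coprime_iff_not_dvd hp').2 him
  -- Since `s` inverts `z.im` modulo `p`, `ω` is congruent to an integer modulo `z`, and then so is
  -- every element.
  have homega : z ∣ (omega : QuadOrder c) - ((-(z.re * s) : ℤ) : QuadOrder c) := by
    have : (omega : QuadOrder c) - ((-(z.re * s) : ℤ) : QuadOrder c)
        = z * (s : QuadOrder c) + (p : QuadOrder c) * ((t : QuadOrder c) * omega) := by
      ext
      · simp
      · simp; linear_combination -hst
    rw [this]
    exact dvd_add (dvd_mul_right _ _) (hpz.mul_right _)
  have hred : ∀ w : QuadOrder c, ∃ m : ℤ, z ∣ w - (m : QuadOrder c) := fun w => by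
    refine ⟨w.re + w.im * (-(z.re * s)), ?_⟩
    have : w - ((w.re + w.im * (-(z.re * s)) : ℤ) : QuadOrder c)
        = (w.im : QuadOrder c) * (omega - ((-(z.re * s) : ℤ) : QuadOrder c)) := by
      ext <;> simp
    rw [this]
    exact homega.mul_left _
  have hint : ∀ m : ℤ, z ∣ (m : QuadOrder c) → (p : ℤ) ∣ m := fun m hm => by
    have := norm_dvd hm
    rw [hz, QuadraticAlgebra.norm_intCast] at this
    exact hp'.dvd_of_dvd_pow this
  have hint' : ∀ m : ℤ, (p : ℤ) ∣ m → z ∣ (m : QuadOrder c) := fun m ⟨k, hk⟩ =>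
    hpz.trans ⟨(k : QuadOrder c), by rw [hk]; push_cast; rfl⟩
  refine ⟨?_, ?_, ?_⟩
  · rintro rfl
    rw [QuadraticAlgebra.norm_zero] at hz
    exact hp'.ne_zero hz.symm
  · rw [isUnit_iff hc, hz]
    exact_mod_cast hp.one_lt.ne'
  · intro u v huv
    obtain ⟨m, hm⟩ := hred u
    obtain ⟨n, hn⟩ := hred v
    have : z ∣ ((m * n : ℤ) : QuadOrder c) := by
      have e : ((m * n : ℤ) : QuadOrder c)
          = u * v - (u - m) * v - (m : QuadOrder c) * (v - n) := by push_cast; ring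
      rw [e]
      exact dvd_sub (dvd_sub huv (hm.mul_right _)) (hn.mul_left _)
    rcases hp'.dvd_or_dvd (hint _ this) with h | h
    · left; simpa using dvd_add hm (hint' _ h)
    · right; simpa using dvd_add hn (hint' _ h)

/-- In a proper factorization of `p`, of norm `p²`, both factors have norm `p`. -/
theorem inertOrNorm_of_ufm (hc : 0 < c) [UniqueFactorizationMonoid (QuadOrder c)] :
    InertOrNorm c := by
  intro p hp
  have := isDomain hc
  by_cases h : Irreducible (p : QuadOrder c)
  · exact Or.inl h.prime
  · right
    have hu : ¬ IsUnit (p : QuadOrder c) := by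
      rw [isUnit_iff hc, QuadraticAlgebra.norm_natCast]
      have := hp.one_lt
      exact_mod_cast (Nat.one_lt_pow two_ne_zero this).ne'
    rw [irreducible_iff] at h
    push Not at h
    obtain ⟨u, v, huv, hu', hv'⟩ := h hu
    rw [isUnit_iff hc] at hu' hv'
    have hN : QuadraticAlgebra.norm u * QuadraticAlgebra.norm v = (p : ℤ) ^ 2 := by
      rw [← map_mul, ← huv, QuadraticAlgebra.norm_natCast]
    lift QuadraticAlgebra.norm u to ℕ using norm_nonneg hc u with U hU
    lift QuadraticAlgebra.norm v to ℕ using norm_nonneg hc v with V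
    norm_cast at hN hu' hv'
    refine ⟨u, ?_⟩
    rw [((Nat.Prime.mul_eq_prime_sq_iff hp hu' hv').1 hN).1] at hU
    exact hU.symm

/-- Kaplansky's criterion: a nonzero prime ideal contains the norm of an element, hence a rational
prime, hence that prime or one of its two conjugate factors, which are prime elements. -/
theorem ufm_of_inertOrNorm (hc : 0 < c) (h : InertOrNorm c) :
    UniqueFactorizationMonoid (QuadOrder c) := by
  have := isDomain hc
  rw [UniqueFactorizationMonoid.iff_exists_prime_mem_of_isPrime]
  intro I hI hI'
  obtain ⟨z, hzI, hz⟩ := Submodule.exists_mem_ne_zero_of_ne_bot hI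
  have hmem : ∀ n : ℕ, n ≠ 0 → (n : QuadOrder c) ∈ I →
      ∃ p : ℕ, p.Prime ∧ (p : QuadOrder c) ∈ I := by
    intro n
    induction n using Nat.recOnMul with
    | zero => simp
    | one =>
      intro _ h1
      exact absurd ((Ideal.eq_top_iff_one I).2 (by simpa using h1)) hI'.ne_top
    | prime p hp => exact fun _ hpI => ⟨p, hp, hpI⟩
    | mul m n hm hn =>
      intro h0 hmn
      rw [Nat.cast_mul] at hmn
      rcases hI'.mem_or_mem hmn with h | h
      · exact hm (left_ne_zero_of_mul h0) h
      · exact hn (right_ne_zero_of_mul h0) h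
  have hN : ((QuadraticAlgebra.norm z).natAbs : QuadOrder c) ∈ I := by
    have : (((QuadraticAlgebra.norm z).natAbs : ℤ) : QuadOrder c) = z * star z := by
      rw [mul_star_eq, Int.natAbs_of_nonneg (norm_nonneg hc z)]
    rw [Int.cast_natCast] at this
    rw [this]
    exact I.mul_mem_right _ hzI
  obtain ⟨p, hp, hpI⟩ := hmem _ (by simpa [norm_eq_zero hc] using hz) hN
  rcases h p hp with h | ⟨w, hw⟩
  · exact ⟨_, hpI, h⟩
  · rw [← mul_star_eq_nat hw] at hpI
    rcases hI'.mem_or_mem hpI with h | h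
    · exact ⟨_, h, prime_of_norm hc hp hw⟩
    · exact ⟨_, h, prime_of_norm hc hp (by rw [QuadraticAlgebra.norm_star, hw])⟩

/-- Descent: a primitive element of norm `p * m`, with all primes below `m + 1` inert or norms,
yields an element of norm `p`. -/
theorem exists_norm_eq_of_primitive (hc : 0 < c) {p : ℕ} (m : ℕ) (hm0 : m ≠ 0)
    (hm : ∀ q : ℕ, q.Prime → q ≤ m →
      Prime (q : QuadOrder c) ∨ ∃ z : QuadOrder c, QuadraticAlgebra.norm z = q)
    (z : QuadOrder c) (hz : QuadraticAlgebra.norm z = p * m)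
    (hprim : ∀ q : ℕ, q.Prime → ¬ (q : QuadOrder c) ∣ z) :
    ∃ w : QuadOrder c, QuadraticAlgebra.norm w = p := by
  induction m using Nat.strong_induction_on generalizing z with
  | _ m ih =>
  rcases eq_or_ne m 1 with rfl | h1
  · exact ⟨z, by simpa using hz⟩
  obtain ⟨q, hq, k, rfl⟩ := Nat.exists_prime_and_dvd h1
  have hk0 : k ≠ 0 := right_ne_zero_of_mul hm0
  have hqm : q ≤ q * k := Nat.le_mul_of_pos_right _ (Nat.pos_of_ne_zero hk0)
  have hkm : k < q * k := lt_mul_of_one_lt_left (Nat.pos_of_ne_zero hk0) hq.one_lt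
  have hqz : (q : QuadOrder c) ∣ z * star z :=
    ⟨((p * k : ℕ) : QuadOrder c), by rw [mul_star_eq, hz]; push_cast; ring⟩
  -- Dividing by a factor of norm `q` replaces the cofactor `q * k` by `k` and keeps primitivity.
  have key : ∀ ρ : QuadOrder c, QuadraticAlgebra.norm ρ = q → ρ ∣ z →
      ∃ w : QuadOrder c, QuadraticAlgebra.norm w = p := by
    rintro ρ hρ ⟨w, rfl⟩
    refine ih k hkm hk0 (fun r hr hrk => hm r hr (hrk.trans hkm.le)) w ?_
      (fun r hr hrw => hprim r hr (hrw.mul_left _))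
    rw [map_mul, hρ] at hz
    have : (q : ℤ) ≠ 0 := by exact_mod_cast hq.ne_zero
    apply mul_left_cancel₀ this
    rw [hz]; push_cast; ring
  rcases hm q hq hqm with h | ⟨ρ, hρ⟩
  · rcases h.dvd_or_dvd hqz with h | h
    · exact absurd h (hprim q hq)
    · rw [dvd_star_iff, star_natCast] at h
      exact absurd h (hprim q hq)
  · have hρz : ρ ∣ z * star z := (Dvd.intro _ (mul_star_eq_nat hρ)).trans hqz
    rcases (prime_of_norm hc hq hρ).dvd_or_dvd hρz with h | h
    · exact key ρ hρ h
    · exact key (star ρ) (by rw [QuadraticAlgebra.norm_star, hρ]) (dvd_star_iff.1 h)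

/-- If `p` is not prime in `QuadOrder c`, then `x² + x + c` has a root modulo `p`. -/
theorem exists_root_of_not_prime (hc : 0 < c) {p : ℕ} (hp : p.Prime)
    (h : ¬ Prime (p : QuadOrder c)) :
    ∃ x : ℤ, 0 ≤ x ∧ 2 * x + 1 ≤ p ∧ (p : ℤ) ∣ x ^ 2 + x + c := by
  have hp' : Prime (p : ℤ) := Nat.prime_iff_prime_int.1 hp
  obtain ⟨z, hpz, hz⟩ : ∃ z : QuadOrder c,
      (p : ℤ) ∣ QuadraticAlgebra.norm z ∧ ¬ (p : QuadOrder c) ∣ z := by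
    by_contra! hcon
    refine h ⟨?_, ?_, fun u v huv => ?_⟩
    · intro h0
      have := congrArg QuadraticAlgebra.norm h0
      rw [QuadraticAlgebra.norm_natCast, QuadraticAlgebra.norm_zero] at this
      exact hp'.ne_zero (pow_eq_zero_iff two_ne_zero |>.1 this)
    · rw [isUnit_iff hc, QuadraticAlgebra.norm_natCast]
      exact_mod_cast (Nat.one_lt_pow two_ne_zero hp.one_lt).ne'
    · have h1 := norm_dvd huv
      rw [QuadraticAlgebra.norm_natCast, map_mul] at h1
      rcases hp'.dvd_or_dvd ((dvd_pow_self _ two_ne_zero).trans h1) with h | h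
      · exact Or.inl (hcon _ h)
      · exact Or.inr (hcon _ h)
  rw [natCast_dvd] at hz
  have him : ¬ (p : ℤ) ∣ z.im := by
    intro him
    refine hz ⟨?_, him⟩
    apply hp'.dvd_of_dvd_pow (n := 2)
    have : z.re ^ 2 = QuadraticAlgebra.norm z - (z.re + c * z.im) * z.im := by rw [norm_eq]; ring
    rw [this]
    exact dvd_sub hpz (him.mul_left _)
  obtain ⟨s, t, hst⟩ : IsCoprime z.im (p : ℤ) := by
    rw [isCoprime_comm]
    exact (Prime.coprime_iff_not_dvd hp').2 him
  -- Scaling `z` by `s` makes its `ω`-coordinate 1 modulo `p`, and `x + ω` has norm `x² + x + c`.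
  have hroot : (p : ℤ) ∣ (s * z.re) ^ 2 + s * z.re + c := by
    have hs : s * z.im = 1 - t * p := by linarith
    have e : (s * z.re) ^ 2 + s * z.re + c
        = s ^ 2 * QuadraticAlgebra.norm z + p * (t * s * z.re + c * (t * (1 + s * z.im))) := by
      rw [norm_eq]
      linear_combination (-(s * z.re) - c * (1 + s * z.im)) * hs
    rw [e]
    exact dvd_add (hpz.mul_left _) (dvd_mul_right _ _)
  set y : ℤ := s * z.re with hy
  have hppos : (0 : ℤ) < p := by exact_mod_cast hp.pos
  have hmod : (p : ℤ) ∣ (y % p) ^ 2 + y % p + c := by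
    have e : (y % p) ^ 2 + y % p + c
        = y ^ 2 + y + c - p * ((y / p) * (y + y % p + 1)) := by
      linear_combination (y % p + y + 1) * (Int.emod_add_mul_ediv y p)
    rw [e]
    exact dvd_sub hroot (dvd_mul_right _ _)
  have h0 := Int.emod_nonneg y hppos.ne'
  have h1 := Int.emod_lt_of_pos y hppos
  by_cases h2 : 2 * (y % p) + 1 ≤ p
  · exact ⟨_, h0, h2, hmod⟩
  -- The two roots modulo `p` sum to `-1`; the other one lies in the lower half.
  · refine ⟨p - 1 - y % p, by omega, by omega, ?_⟩
    have e : (p - 1 - y % p) ^ 2 + (p - 1 - y % p) + c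
        = (y % p) ^ 2 + y % p + c + p * (p - 1 - 2 * (y % p)) := by ring
    rw [e]
    exact dvd_add hmod (dvd_mul_right _ _)

/-- The Minkowski-type criterion: only the primes `p` with `3p² < 4c` have to be inspected. -/
theorem inertOrNorm_of_no_small_roots (hc : 0 < c)
    (h : ∀ p : ℕ, p.Prime → 3 * (p : ℤ) ^ 2 < 4 * c → ∀ x : ℤ, 0 ≤ x → 2 * x + 1 ≤ p →
      ¬ (p : ℤ) ∣ x ^ 2 + x + c) : InertOrNorm c := by
  intro p
  induction p using Nat.strong_induction_on with
  | _ p ih =>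
  intro hp
  by_contra! hcon
  obtain ⟨x, hx0, hxp, m, hm⟩ := exists_root_of_not_prime hc hp hcon.1
  have hbig : 4 * c ≤ 3 * (p : ℤ) ^ 2 := by
    by_contra! hlt
    exact h p hp hlt x hx0 hxp ⟨m, hm⟩
  have hppos : (0 : ℤ) < p := by exact_mod_cast hp.pos
  have hmpos : 0 < m := by
    have : 0 < (p : ℤ) * m := by rw [← hm]; positivity
    exact pos_of_mul_pos_right this hppos.le
  -- `4pm = (2x + 1)² + 4c - 1 < p² + 3p²`. Hence all primes up to `m` are covered by induction, and
  -- `x + ω` is primitive of norm `p * m`.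
  have hmlt : m < p := by
    have h1 : (2 * x + 1) ^ 2 ≤ (p : ℤ) ^ 2 := by gcongr
    have : (p : ℤ) * m < p * p := by nlinarith
    exact lt_of_mul_lt_mul_left this hppos.le
  lift m to ℕ using hmpos.le
  obtain ⟨w, hw⟩ := exists_norm_eq_of_primitive hc (p := p) m (by omega)
    (fun q hq hqm => ih q (by omega) hq) ⟨x, 1⟩
    (by rw [norm_eq]; simp only; linear_combination hm) (fun q hq hd => by
      have := (natCast_dvd.1 hd).2
      simp only at this
      exact (Nat.prime_iff_prime_int.1 hq).not_isUnit (isUnit_of_dvd_one this))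
  exact hcon.2 w hw

theorem inertOrNorm_of_mem {c : ℤ} (hc : c ∈ ({3, 5, 11, 17, 41} : Finset ℤ)) :
    InertOrNorm c := by
  have hpos : 0 < c := by
    simp only [Finset.mem_insert, Finset.mem_singleton] at hc; omega
  refine inertOrNorm_of_no_small_roots hpos fun p hp hlt x hx0 hxp => ?_
  -- `3 * 8² > 4 * 41`, so only `p ≤ 7` and `x ≤ 3` are left to check.
  have hp8 : p < 8 := by
    simp only [Finset.mem_insert, Finset.mem_singleton] at hc
    have : c ≤ 41 := by omega
    by_contra! h8
    have : (8 : ℤ) ≤ p := by exact_mod_cast h8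
    nlinarith
  simp only [Finset.mem_insert, Finset.mem_singleton] at hc
  rcases hc with rfl | rfl | rfl | rfl | rfl <;> interval_cases p <;>
    first
    | (exfalso; norm_num at hp; done)
    | (exfalso; norm_num at hlt; done)
    | (have hx4 : x < 4 := by omega
       interval_cases x <;> first | (exfalso; norm_num at hxp; done) | norm_num)

end QuadOrder
end NormRep

/-! ### Integers of `ℚ(√-a)` and the shape of Heegner numbers -/

namespace NormRep

open QuadraticAlgebra

/-- Trace and norm of an algebraic integer of `ℚ(√-a)` are rational integers. -/
theorem exists_int_of_isIntegral {a : ℕ} {z : QSqrt a} (hz : IsIntegral ℤ z) :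
    ∃ t m : ℤ, 2 * z.re = t ∧ z.re ^ 2 + a * z.im ^ 2 = m := by
  have hs : IsIntegral ℤ (star z) :=
    map_isIntegral_int (starRingEnd (QSqrt a)) hz
  have hint : ∀ r : ℚ, IsIntegral ℤ (algebraMap ℚ (QSqrt a) r) → ∃ t : ℤ, r = t := fun r hr => by
    rw [isIntegral_algebraMap_iff (algebraMap ℚ (QSqrt a)).injective] at hr
    obtain ⟨t, ht⟩ := IsIntegrallyClosed.isIntegral_iff.1 hr
    exact ⟨t, by rw [← ht]; simp⟩
  obtain ⟨t, ht⟩ := hint (trace z) (by rw [algebraMap_trace_eq_add_star]; exact hz.add hs)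
  obtain ⟨m, hm⟩ := hint (QuadraticAlgebra.norm z)
    (by rw [algebraMap_norm_eq_mul_star]; exact hz.mul hs)
  refine ⟨t, m, ?_, ?_⟩
  · rw [← ht, trace_def]; simp
  · rw [← hm, QuadraticAlgebra.norm_def]; ring

/-- The coordinates of an algebraic integer of `ℚ(√-a)` are half-integers. -/
theorem exists_half_int {a : ℕ} (ha : Squarefree a) {z : QSqrt a} (hz : IsIntegral ℤ z) :
    ∃ t v m : ℤ, 2 * z.re = t ∧ 2 * z.im = v ∧ z.re ^ 2 + a * z.im ^ 2 = m ∧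
      t ^ 2 + a * v ^ 2 = 4 * m := by
  obtain ⟨t, m, ht, hm⟩ := exists_int_of_isIntegral hz
  have hv : (a : ℚ) * (2 * z.im) ^ 2 = ((4 * m - t ^ 2 : ℤ) : ℚ) := by
    push_cast; rw [← ht, ← hm]; ring
  set w : ℚ := 2 * z.im with hw
  have hden : w.den = 1 := by
    have h1 : (a : ℤ) * w.num ^ 2 = (4 * m - t ^ 2) * (w.den : ℤ) ^ 2 := by
      have hd : (w.den : ℚ) ≠ 0 := by exact_mod_cast w.den_nz
      have : (a : ℚ) * (w.num : ℚ) ^ 2 = ((4 * m - t ^ 2 : ℤ) : ℚ) * (w.den : ℚ) ^ 2 := by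
        rw [← hv]
        nth_rewrite 2 [← Rat.num_div_den w]
        field_simp
      exact_mod_cast this
    -- As `a * w²` is an integer, the squared denominator must cancel against the square-free `a`.
    have h2 : w.den * w.den ∣ a := by
      have h3 : (w.den : ℤ) ^ 2 ∣ (a : ℤ) * w.num ^ 2 := ⟨_, by rw [h1, mul_comm]⟩
      have h4 : IsCoprime ((w.den : ℤ) ^ 2) (w.num ^ 2) :=
        (Rat.isCoprime_num_den w).symm.pow
      have := h4.dvd_of_dvd_mul_right h3
      rw [← sq]
      exact_mod_cast this
    exact Nat.isUnit_iff.1 (ha _ h2)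
  have hwn : w = w.num := by
    nth_rewrite 1 [← Rat.num_div_den w]; simp [hden]
  refine ⟨t, w.num, m, ht, hwn, hm, ?_⟩
  rw [hwn] at hv
  have : (a : ℤ) * w.num ^ 2 = 4 * m - t ^ 2 := by exact_mod_cast hv
  linarith

section Heegner

variable {a : ℕ}

theorem norm_ringOfInt_ne {p : ℕ} (ha : Squarefree a) (hp : ∀ t v : ℤ, t ^ 2 + a * v ^ 2 ≠ 4 * p)
    (z : ringOfInt a) : QuadraticAlgebra.norm (z : QSqrt a) ≠ p := by
  intro h
  obtain ⟨t, v, m, -, -, hm, h4⟩ := exists_half_int ha z.2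
  have : (m : ℚ) = p := by rw [← hm, ← h, QuadraticAlgebra.norm_def]; ring
  have : m = p := by exact_mod_cast this
  exact hp t v (by rw [h4, this])

theorem exists_norm_ringOfInt (z : ringOfInt a) :
    ∃ m : ℕ, QuadraticAlgebra.norm (z : QSqrt a) = m := by
  obtain ⟨t, m, -, hm⟩ := exists_int_of_isIntegral z.2
  have h : QuadraticAlgebra.norm (z : QSqrt a) = m := by
    rw [← hm, QuadraticAlgebra.norm_def]; ring
  have h0 : (0 : ℚ) ≤ m := by rw [← hm]; positivity
  lift m to ℕ using (by exact_mod_cast h0)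
  exact ⟨m, by simpa using h⟩

/-- If `ringOfInt a` is factorial and has no element of norm `p`, then `p` is prime in it, so that
`p` divides each integer whose norm it divides. -/
theorem isIntegral_div_of_dvd_norm (h : IsHeegner a) {p : ℕ} (hp : p.Prime)
    (hno : ∀ t v : ℤ, t ^ 2 + a * v ^ 2 ≠ 4 * p) {z : QSqrt a} (hz : IsIntegral ℤ z) {k : ℤ}
    (hk : QuadraticAlgebra.norm z = p * k) : IsIntegral ℤ ((p : ℚ)⁻¹ • z) := by
  obtain ⟨ha, hufm⟩ := h
  have hp0 : (p : ℚ) ≠ 0 := by exact_mod_cast hp.ne_zero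
  have hunit : ∀ u : ringOfInt a, QuadraticAlgebra.norm (u : QSqrt a) = 1 → IsUnit u := by
    intro u hu
    have hs : IsIntegral ℤ (star (u : QSqrt a)) := map_isIntegral_int (starRingEnd (QSqrt a)) u.2
    refine IsUnit.of_mul_eq_one ⟨star (u : QSqrt a), hs⟩ (Subtype.ext ?_)
    change (u : QSqrt a) * star (u : QSqrt a) = 1
    rw [← algebraMap_norm_eq_mul_star, hu, map_one]
  -- Two nonunit factors of `p` would both have norm `p`, which `hno` rules out.
  have hirr : Irreducible (p : ringOfInt a) := by
    rw [irreducible_iff]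
    constructor
    · rintro hu
      obtain ⟨v, hv⟩ := hu.exists_right_inv
      obtain ⟨m, hm⟩ := exists_norm_ringOfInt v
      have := congrArg (fun x : ringOfInt a => QuadraticAlgebra.norm (x : QSqrt a)) hv
      simp only [MulMemClass.coe_mul, map_mul, hm, OneMemClass.coe_one, map_one] at this
      have e : (((p : ringOfInt a) : QSqrt a)) = (p : QSqrt a) := by simp
      rw [e, QuadraticAlgebra.norm_natCast] at this
      have h1 : p ^ 2 * m = 1 := by exact_mod_cast this
      have h2 := Nat.eq_one_of_mul_eq_one_right h1
      exact hp.one_lt.ne' ((Nat.pow_eq_one.1 h2).resolve_right two_ne_zero)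
    · intro u v huv
      obtain ⟨k, hk⟩ := exists_norm_ringOfInt u
      obtain ⟨m, hm⟩ := exists_norm_ringOfInt v
      have := congrArg (fun x : ringOfInt a => QuadraticAlgebra.norm (x : QSqrt a)) huv
      simp only [MulMemClass.coe_mul, map_mul, hm, hk] at this
      have e : (((p : ringOfInt a) : QSqrt a)) = (p : QSqrt a) := by simp
      rw [e, QuadraticAlgebra.norm_natCast] at this
      have h1 : k * m = p ^ 2 := by exact_mod_cast this.symm
      by_contra! hcon
      have hk1 : k ≠ 1 := by rintro rfl; exact hcon.1 (hunit u (by simpa using hk))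
      have hm1 : m ≠ 1 := by rintro rfl; exact hcon.2 (hunit v (by simpa using hm))
      rw [((Nat.Prime.mul_eq_prime_sq_iff hp hk1 hm1).1 h1).1] at hk
      exact norm_ringOfInt_ne ha hno u hk
  have hprime := hirr.prime
  have hs : IsIntegral ℤ (star z) := map_isIntegral_int (starRingEnd (QSqrt a)) hz
  have hdvd : (p : ringOfInt a) ∣ ⟨z, hz⟩ * ⟨star z, hs⟩ := by
    refine ⟨(k : ringOfInt a), Subtype.ext ?_⟩
    change z * star z = _
    rw [← algebraMap_norm_eq_mul_star, hk]
    simp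
  have hdiv : ∀ w w' : QSqrt a, w = (p : QSqrt a) * w' → (p : ℚ)⁻¹ • w = w' := by
    rintro w w' rfl
    ext <;> simp [hp0]
  rcases hprime.dvd_or_dvd hdvd with ⟨w, hw⟩ | ⟨w, hw⟩
  · have := congrArg Subtype.val hw
    rw [hdiv z w (by simpa using this)]
    exact w.2
  · have := congrArg Subtype.val hw
    have h1 := hdiv (star z) w (by simpa using this)
    have h2 : (p : ℚ)⁻¹ • z = star (w : QSqrt a) := by
      rw [← h1]; ext <;> simp
    rw [h2]
    exact map_isIntegral_int (starRingEnd (QSqrt a)) w.2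

theorem isIntegral_of_trace_norm {z : QSqrt a} {t m : ℤ} (ht : 2 * z.re = t)
    (hm : z.re ^ 2 + a * z.im ^ 2 = m) : IsIntegral ℤ z := by
  refine ⟨Polynomial.X ^ 2 + Polynomial.C (-t) * Polynomial.X + Polynomial.C m, by monicity!, ?_⟩
  simp only [Polynomial.eval₂_add, Polynomial.eval₂_mul, Polynomial.eval₂_pow, Polynomial.eval₂_X,
    Polynomial.eval₂_C]
  simp only [eq_intCast, Int.cast_neg]
  ext
  · simp [sq]; linear_combination z.re * ht - hm
  · simp [sq]; linear_combination z.im * ht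

theorem isIntegral_mk_int (x y : ℤ) : IsIntegral ℤ (⟨x, y⟩ : QSqrt a) :=
  isIntegral_of_trace_norm (t := 2 * x) (m := x ^ 2 + a * y ^ 2) (by simp) (by simp)

/-- No integer has norm 2, because `t² + a v² = 8` is unsolvable for `a ≥ 11`. Hence an integer of
even norm stays integral after halving. This fails for `√-a` if `a` is even, for `1 + √-a` if `a ≡
1` modulo 4, and for `(1 + √-a)/2` if `a ≡ 7` modulo 8. -/
theorem IsHeegner.mod_eight (h : IsHeegner a) (h11 : 11 ≤ a) : a % 8 = 3 := by
  have h11' : (11 : ℤ) ≤ a := by exact_mod_cast h11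
  have hno : ∀ t v : ℤ, t ^ 2 + a * v ^ 2 ≠ 4 * (2 : ℕ) := by
    intro t v htv
    push_cast at htv
    have hv : v = 0 := by
      by_contra hne
      have : 0 < v ^ 2 := by positivity
      nlinarith [sq_nonneg t]
    subst hv
    have h3 : t < 3 := by nlinarith
    have h3' : -3 < t := by nlinarith
    interval_cases t <;> omega
  have h4 : ¬ 4 ∣ a := fun h4 => by
    have := Nat.isUnit_iff.1 (h.1 2 (by simpa using h4)); omega
  have even_case : ¬ a % 2 = 0 := by
    intro h2
    obtain ⟨k, hk⟩ : ∃ k : ℕ, a = 2 * k := ⟨a / 2, by omega⟩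
    have hk' : (a : ℚ) = 2 * k := by exact_mod_cast hk
    have hi := isIntegral_div_of_dvd_norm h Nat.prime_two hno (isIntegral_mk_int (a := a) 0 1)
      (k := k) (by rw [QuadraticAlgebra.norm_def]; simpa using hk')
    obtain ⟨t, m, ht, hm⟩ := exists_int_of_isIntegral hi
    simp at hm
    have : (a : ℚ) = 4 * m := by rw [← hm]; ring
    have : (a : ℤ) = 4 * m := by exact_mod_cast this
    omega
  have one_case : ¬ a % 4 = 1 := by
    intro h1
    obtain ⟨k, hk⟩ : ∃ k : ℕ, a + 1 = 2 * k := ⟨(a + 1) / 2, by omega⟩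
    have hk' : (a : ℚ) + 1 = 2 * k := by exact_mod_cast hk
    have hi := isIntegral_div_of_dvd_norm h Nat.prime_two hno (isIntegral_mk_int (a := a) 1 1)
      (k := k) (by rw [QuadraticAlgebra.norm_def]; simp; linarith)
    obtain ⟨t, m, ht, hm⟩ := exists_int_of_isIntegral hi
    simp at hm
    have : (a : ℚ) + 1 = 4 * m := by rw [← hm]; ring
    have : (a : ℤ) + 1 = 4 * m := by exact_mod_cast this
    omega
  have seven_case : ¬ a % 8 = 7 := by
    intro h7
    obtain ⟨k, hk⟩ : ∃ k : ℕ, a = 8 * k + 7 := ⟨a / 8, by omega⟩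
    have hk' : (a : ℚ) = 8 * k + 7 := by exact_mod_cast hk
    have hw : IsIntegral ℤ (⟨1 / 2, 1 / 2⟩ : QSqrt a) := by
      refine isIntegral_of_trace_norm (t := 1) (m := 2 * k + 2) (by norm_num) ?_
      push_cast
      rw [hk']; ring
    have hi := isIntegral_div_of_dvd_norm h Nat.prime_two hno hw (k := k + 1) (by
        rw [QuadraticAlgebra.norm_def]; simp; rw [hk']; ring)
    obtain ⟨t, m, ht, hm⟩ := exists_int_of_isIntegral hi
    simp at ht
    have : (1 : ℚ) = 2 * t := by rw [← ht]; norm_num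
    have : (1 : ℤ) = 2 * t := by exact_mod_cast this
    omega
  omega

/-- If `a = r * s` with `r` prime and `s > 1`, no integer has norm `r`. So `√-a / r` is integral,
its norm `s / r` is an integer, and `r²` divides the square-free `a`. -/
theorem IsHeegner.prime (h : IsHeegner a) (h11 : 11 ≤ a) : a.Prime := by
  have h8 := h.mod_eight h11
  by_contra hnp
  obtain ⟨r, hr, hra⟩ := Nat.exists_prime_and_dvd (n := a) (by omega)
  obtain ⟨s, rfl⟩ := hra
  have hs1 : s ≠ 1 := by rintro rfl; exact hnp (by simpa using hr)
  have hrodd : r ≠ 2 := by rintro rfl; omega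
  have hr3 : 3 ≤ r := by have := hr.two_le; omega
  have hs3 : 3 ≤ s := by
    rcases s with _ | _ | _ | s
    · omega
    · omega
    · omega
    · omega
  have hno : ∀ t v : ℤ, t ^ 2 + (r * s : ℕ) * v ^ 2 ≠ 4 * (r : ℕ) := by
    intro t v htv
    have hr' : Prime (r : ℤ) := Nat.prime_iff_prime_int.1 hr
    obtain ⟨t, rfl⟩ : (r : ℤ) ∣ t := hr'.dvd_of_dvd_pow (n := 2) (by
      have : t ^ 2 = r * (4 - s * v ^ 2) := by push_cast at htv; linear_combination htv
      exact ⟨_, this⟩)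
    -- With `r` and `s` odd and at least 3, the left side can only be `0`, `r`, `s`, at least 6, or
    -- too large.
    have h4 : r * t ^ 2 + s * v ^ 2 = 4 := by
      apply mul_left_cancel₀ hr'.ne_zero
      push_cast at htv; linear_combination htv
    have hr3' : (3 : ℤ) ≤ r := by exact_mod_cast hr3
    have hs3' : (3 : ℤ) ≤ s := by exact_mod_cast hs3
    have ht2 : t ^ 2 ≤ 1 := by nlinarith [sq_nonneg t, sq_nonneg v]
    have hv2 : v ^ 2 ≤ 1 := by nlinarith [sq_nonneg t, sq_nonneg v]
    have hrs : ¬ (2 : ℤ) ∣ r * s := by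
      have : ((r * s : ℕ) : ℤ) % 8 = 3 := by omega
      push_cast at this
      omega
    have ht0 := sq_nonneg t
    have hv0 := sq_nonneg v
    generalize t ^ 2 = T at *
    generalize v ^ 2 = V at *
    interval_cases T <;> interval_cases V
    · omega
    · exact hrs (Dvd.dvd.mul_left ⟨2, by omega⟩ _)
    · exact hrs (Dvd.dvd.mul_right ⟨2, by omega⟩ _)
    · omega
  have hi := isIntegral_div_of_dvd_norm h hr hno (isIntegral_mk_int (a := r * s) 0 1) (k := s)
    (by rw [QuadraticAlgebra.norm_def]; simp)
  obtain ⟨t, m, ht, hm⟩ := exists_int_of_isIntegral hi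
  have hr0 : (r : ℚ) ≠ 0 := by exact_mod_cast hr.ne_zero
  simp at hm
  have : (s : ℚ) = r * m := by rw [← hm]; field_simp
  have : (s : ℤ) = r * m := by exact_mod_cast this
  have hrs : r ∣ s := by
    have : (r : ℤ) ∣ s := ⟨m, this⟩
    exact_mod_cast this
  have := Nat.isUnit_iff.1 (h.1 r (Nat.mul_dvd_mul_left r hrs))
  omega

end Heegner

/-- The embedding `x + yω ↦ x + y(1 + √-a)/2` for `a = 4c - 1`. -/
noncomputable def quadEmb {a : ℕ} {c : ℤ} (h : (a : ℤ) = 4 * c - 1) : QuadOrder c →ₐ[ℤ] QSqrt a :=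
  lift ⟨⟨1 / 2, 1 / 2⟩, by
    have h' : (a : ℚ) = 4 * c - 1 := by exact_mod_cast h
    ext
    · simp; rw [h']; ring
    · simp; norm_num⟩

section quadEmb

variable {a : ℕ} {c : ℤ} (h : (a : ℤ) = 4 * c - 1)

theorem quadEmb_apply (z : QuadOrder c) :
    quadEmb h z = ⟨z.re + z.im / 2, z.im / 2⟩ := by
  simp only [quadEmb, lift]
  ext <;> simp <;> ring

theorem quadEmb_injective : Function.Injective (quadEmb h) := by
  intro z w hzw
  rw [quadEmb_apply, quadEmb_apply, QuadraticAlgebra.mk.injEq] at hzw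
  have him : (z.im : ℚ) = w.im := by linarith [hzw.2]
  have hre : (z.re : ℚ) = w.re := by linarith [hzw.1]
  ext
  · exact_mod_cast hre
  · exact_mod_cast him

theorem norm_quadEmb (z : QuadOrder c) :
    QuadraticAlgebra.norm (quadEmb h z) = (QuadraticAlgebra.norm z : ℤ) := by
  have h' : (a : ℚ) = 4 * c - 1 := by exact_mod_cast h
  rw [quadEmb_apply, QuadraticAlgebra.norm_def, QuadraticAlgebra.norm_def]
  push_cast
  rw [h']; ring

theorem isIntegral_quadEmb (z : QuadOrder c) : IsIntegral ℤ (quadEmb h z) :=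
  (Algebra.IsIntegral.isIntegral z).map (quadEmb h)

theorem exists_quadEmb_eq (ha : Squarefree a) {z : QSqrt a} (hz : IsIntegral ℤ z) :
    ∃ w : QuadOrder c, quadEmb h w = z := by
  obtain ⟨t, v, m, ht, hv, -, h4⟩ := exists_half_int ha hz
  -- `a ≡ -1` modulo 4 makes `t² ≡ v²`, so the half-integral coordinates have numerators of equal
  -- parity.
  have hpar : (2 : ℤ) ∣ t - v := by
    have h1 : (2 : ℤ) ∣ (t - v) ^ 2 :=
      ⟨2 * m - t * v + (1 - 2 * c) * v ^ 2, by rw [h] at h4; linear_combination h4⟩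
    exact Int.prime_two.dvd_of_dvd_pow h1
  obtain ⟨x, hx⟩ := hpar
  refine ⟨⟨x, v⟩, ?_⟩
  have hx' : (t : ℚ) - v = 2 * x := by exact_mod_cast hx
  rw [quadEmb_apply]
  ext
  · simp only; linarith
  · simp only; linarith

/-- `QuadOrder c` is the ring of integers of `ℚ(√-a)` for square-free `a = 4c - 1`. -/
noncomputable def quadEquiv (ha : Squarefree a) : QuadOrder c ≃+* ringOfInt a :=
  RingEquiv.ofBijective ((quadEmb h).codRestrict (ringOfInt a) (isIntegral_quadEmb h))
    ⟨fun _ _ hzw => quadEmb_injective h (congrArg Subtype.val hzw),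
      fun z => (exists_quadEmb_eq h ha z.2).imp fun _ hw => Subtype.ext hw⟩

theorem coe_quadEquiv (ha : Squarefree a) (z : QuadOrder c) :
    (quadEquiv h ha z : QSqrt a) = quadEmb h z := rfl

end quadEmb

theorem isHeegner_of_inertOrNorm {a : ℕ} {c : ℤ} (h : (a : ℤ) = 4 * c - 1) (hc : 0 < c)
    (ha : Squarefree a) (hin : InertOrNorm c) : IsHeegner a :=
  ⟨ha, (quadEquiv h ha).toMulEquiv.uniqueFactorizationMonoid
    (QuadOrder.ufm_of_inertOrNorm hc hin)⟩

theorem IsHeegner.inertOrNorm {a : ℕ} {c : ℤ} (h : (a : ℤ) = 4 * c - 1) (hc : 0 < c)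
    (ha : IsHeegner a) : InertOrNorm c :=
  have := (quadEquiv h ha.1).symm.toMulEquiv.uniqueFactorizationMonoid ha.2
  QuadOrder.inertOrNorm_of_ufm hc

theorem isHeegner_of_mem {a : ℕ} (ha : a ∈ ({11, 19, 43, 67, 163} : Finset ℕ)) :
    IsHeegner a := by
  have hp : a.Prime := by
    simp only [Finset.mem_insert, Finset.mem_singleton] at ha
    rcases ha with rfl | rfl | rfl | rfl | rfl <;> norm_num
  obtain ⟨c, hc, h⟩ : ∃ c ∈ ({3, 5, 11, 17, 41} : Finset ℤ), (a : ℤ) = 4 * c - 1 := by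
    simp only [Finset.mem_insert, Finset.mem_singleton] at ha
    rcases ha with rfl | rfl | rfl | rfl | rfl
    exacts [⟨3, by simp⟩, ⟨5, by simp⟩, ⟨11, by simp⟩, ⟨17, by simp⟩, ⟨41, by simp⟩]
  exact isHeegner_of_inertOrNorm h (by have := hp.pos; omega) hp.squarefree
    (QuadOrder.inertOrNorm_of_mem hc)

end NormRep

/-! ### Elements of given norm, and the cubic character modulo 2 -/

namespace NormRep

open QuadraticAlgebra Finset

namespace QuadOrder

variable {c : ℤ}

theorem finite_norm_eq (hc : 0 < c) (n : ℕ) :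
    {z : QuadOrder c | QuadraticAlgebra.norm z = n}.Finite := by
  refine Set.Finite.of_finite_image (f := fun z => (z.re, z.im))
    (((Set.finite_Icc (-(4 * n : ℤ)) (4 * n)).prod (Set.finite_Icc (-(4 * n : ℤ)) (4 * n))).subset
      ?_) (fun z _ w _ h => QuadraticAlgebra.ext (congrArg Prod.fst h) (congrArg Prod.snd h))
  rintro _ ⟨z, hz, rfl⟩
  simp only [Set.mem_ofPred_eq] at hz
  have h4 := four_mul_norm z
  rw [hz] at h4
  have h1 : z.im ^ 2 ≤ 4 * n := by nlinarith [sq_nonneg (2 * z.re + z.im), sq_nonneg z.im]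
  have h2 : (2 * z.re + z.im) ^ 2 ≤ 4 * n := by nlinarith [sq_nonneg z.im]
  have h3 : |z.im| ≤ 4 * n := abs_le.2
    ⟨by nlinarith [Int.le_self_sq (-z.im)], by nlinarith [Int.le_self_sq z.im]⟩
  have h5 : |2 * z.re + z.im| ≤ 4 * n := abs_le.2
    ⟨by nlinarith [Int.le_self_sq (-(2 * z.re + z.im))],
      by nlinarith [Int.le_self_sq (2 * z.re + z.im)]⟩
  rw [abs_le] at h3 h5
  simp only [Set.mem_prod, Set.mem_Icc]
  omega

/-- The finite set of elements of norm `n`. -/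
noncomputable def sphere (hc : 0 < c) (n : ℕ) : Finset (QuadOrder c) :=
  (finite_norm_eq hc n).toFinset

@[simp]
theorem mem_sphere (hc : 0 < c) {n : ℕ} {z : QuadOrder c} :
    z ∈ sphere hc n ↔ QuadraticAlgebra.norm z = n := by
  simp [sphere]

/-- For odd `c` the form `x² + xy + cy²` is anisotropic modulo 2, so 2 is inert. -/
theorem even_norm_iff (hodd : Odd c) {z : QuadOrder c} :
    Even (QuadraticAlgebra.norm z) ↔ Even z.re ∧ Even z.im := by
  have hc : ¬ Even c := Int.not_even_iff_odd.2 hodd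
  rw [norm_eq]
  simp only [Int.even_add, Int.even_mul, Int.even_pow, hc]
  tauto

section chi

variable {K : Type*} [Field K]

/-- The cubic residue character modulo the inert prime `2`, sending `ω` to `ζ`. -/
def chi (ζ : K) (z : QuadOrder c) : K :=
  -- The class with both coordinates odd is `1 + ω`, which for odd `c` is `ω²` modulo 2; hence the
  -- value `ζ ^ 2`.
  if Even z.im then (if Even z.re then 0 else 1) else if Even z.re then ζ else ζ ^ 2

theorem chi_mul (hodd : Odd c) {ζ : K} (hζ : ζ ^ 3 = 1) (z w : QuadOrder c) :
    chi ζ (z * w) = chi ζ z * chi ζ w := by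
  have hc : ¬ Even c := Int.not_even_iff_odd.2 hodd
  have h4 : ζ ^ 2 * ζ ^ 2 = ζ := by linear_combination ζ * hζ
  have h3 : ζ * ζ ^ 2 = 1 := by linear_combination hζ
  have h3' : ζ ^ 2 * ζ = 1 := by linear_combination hζ
  simp only [chi, re_mul, im_mul, Int.even_add, Int.even_mul, even_neg, hc, one_mul]
  by_cases h1 : Even z.re <;> by_cases h2 : Even z.im <;> by_cases h5 : Even w.re <;>
    by_cases h6 : Even w.im <;> simp [h1, h2, h5, h6, h4, h3, h3', ← sq]

theorem chi_one (ζ : K) : chi ζ (1 : QuadOrder c) = 1 := by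
  simp [chi, re_one, im_one]

theorem chi_pow (hodd : Odd c) {ζ : K} (hζ : ζ ^ 3 = 1) (z : QuadOrder c) (k : ℕ) :
    chi ζ (z ^ k) = chi ζ z ^ k := by
  induction k with
  | zero => simp [chi_one]
  | succ k ih => rw [pow_succ, chi_mul hodd hζ, ih, pow_succ]

/-- Conjugation swaps the classes of `ω` and `1 + ω`: it is the Frobenius of `𝔽₄` when `c` is odd.
-/
theorem chi_star {ζ : K} (hζ : ζ ^ 3 = 1) (z : QuadOrder c) :
    chi ζ (star z) = chi ζ z ^ 2 := by
  have h4 : (ζ ^ 2) ^ 2 = ζ := by linear_combination ζ * hζ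
  simp only [chi, re_star, im_star, one_mul, even_neg, Int.even_add]
  by_cases h1 : Even z.re <;> by_cases h2 : Even z.im <;> simp [h1, h2, h4]

theorem chi_eq_one_of_even {ζ : K} (hodd : Odd c) {z : QuadOrder c} {n : ℕ} (hn : Odd n)
    (hz : QuadraticAlgebra.norm z = n) (him : Even z.im) : chi ζ z = 1 := by
  have : ¬ Even (QuadraticAlgebra.norm z) := by
    rw [hz, Int.even_coe_nat, Nat.not_even_iff_odd]; exact hn
  rw [even_norm_iff hodd] at this
  rw [chi, if_pos him, if_neg (fun h => this ⟨h, him⟩)]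

theorem chi_sq_add_chi_add_one {ζ : K} (hζ : ζ ^ 2 + ζ + 1 = 0) {z : QuadOrder c}
    (him : ¬ Even z.im) : chi ζ z ^ 2 + chi ζ z + 1 = 0 := by
  rw [chi, if_neg him]
  split_ifs
  · exact hζ
  · linear_combination (ζ ^ 2 - ζ + 1) * hζ

end chi

/-! ### Sums over elements of norm `p ^ k * m`, by splitting type of `p` -/

section sums

variable {K : Type*} [Field K]

/-- Dividing out an element by which all elements of norm `s * m` are divisible. -/
theorem sum_sphere_mul_of_dvd (hc : 0 < c) {s m : ℕ} (hs : s ≠ 0) {α : QuadOrder c}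
    (hα : QuadraticAlgebra.norm α = s)
    (hdvd : ∀ z : QuadOrder c, QuadraticAlgebra.norm z = (s * m : ℕ) → α ∣ z)
    (f : QuadOrder c → K) :
    ∑ z ∈ sphere hc (s * m), f z = ∑ z ∈ sphere hc m, f (α * z) := by
  have := isDomain hc
  have hs' : (s : ℤ) ≠ 0 := by exact_mod_cast hs
  have hα0 : α ≠ 0 := by
    rintro rfl
    rw [QuadraticAlgebra.norm_zero] at hα
    exact hs' hα.symm
  symm
  refine sum_nbij (fun z => α * z) ?_ ?_ ?_ (fun _ _ => rfl)
  · intro z hz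
    rw [mem_sphere] at hz ⊢
    rw [map_mul, hα, hz]; push_cast; rfl
  · exact fun z _ w _ h => mul_left_cancel₀ hα0 h
  · intro z hz
    rw [mem_coe, mem_sphere] at hz
    obtain ⟨w, rfl⟩ := hdvd z hz
    refine ⟨w, ?_, rfl⟩
    rw [mem_coe, mem_sphere]
    rw [map_mul, hα] at hz
    apply mul_left_cancel₀ hs'
    rw [hz]; push_cast; rfl

/-- An element of norm `p ^ k * m`, where `p` is the norm of `π`, is divisible by some
`π ^ i * star π ^ (k - i)`. -/
theorem exists_eq_pow_mul_star_pow (hc : 0 < c) {p m : ℕ} (hp : p.Prime) {π : QuadOrder c}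
    (hπ : QuadraticAlgebra.norm π = p) (k : ℕ) (z : QuadOrder c)
    (hz : QuadraticAlgebra.norm z = (p ^ k * m : ℕ)) :
    ∃ i j : ℕ, ∃ w : QuadOrder c, i + j = k ∧ QuadraticAlgebra.norm w = m ∧
      z = π ^ i * star π ^ j * w := by
  have hp0 : (p : ℤ) ≠ 0 := by exact_mod_cast hp.ne_zero
  induction k generalizing z with
  | zero => exact ⟨0, 0, z, rfl, by simpa using hz, by simp⟩
  | succ k ih =>
    have hπz : π ∣ z * star z := by
      rw [mul_star_eq_nat hz]
      refine (Dvd.intro _ (mul_star_eq_nat hπ)).trans ?_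
      exact Nat.cast_dvd_cast ((dvd_pow_self p (Nat.succ_ne_zero k)).mul_right m)
    have hcancel : ∀ w : QuadOrder c, (p : ℤ) * QuadraticAlgebra.norm w = (p ^ (k + 1) * m : ℕ) →
        QuadraticAlgebra.norm w = (p ^ k * m : ℕ) := fun w hw => by
      apply mul_left_cancel₀ hp0
      rw [hw]; push_cast; ring
    rcases (prime_of_norm hc hp hπ).dvd_or_dvd hπz with ⟨w, rfl⟩ | h
    · obtain ⟨i, j, v, hij, hv, rfl⟩ := ih w (hcancel w (by rw [← hz, map_mul, hπ]))
      exact ⟨i + 1, j, v, by omega, hv, by ring⟩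
    · obtain ⟨w, rfl⟩ := dvd_star_iff.1 h
      obtain ⟨i, j, v, hij, hv, rfl⟩ := ih w (hcancel w (by
        rw [← hz, map_mul, QuadraticAlgebra.norm_star, hπ]))
      exact ⟨i, j + 1, v, by omega, hv, by ring⟩

/-- Elements of norm `p ^ k * m` for a split prime `p` not dividing `m`. -/
theorem sum_sphere_split (hc : 0 < c) {p m : ℕ} (hp : p.Prime) (hpm : ¬ p ∣ m) {π : QuadOrder c}
    (hπ : QuadraticAlgebra.norm π = p) (hns : ¬ π ∣ star π) (k : ℕ) (f : QuadOrder c → K) :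
    ∑ z ∈ sphere hc (p ^ k * m), f z =
      ∑ ij ∈ antidiagonal k, ∑ w ∈ sphere hc m, f (π ^ ij.1 * star π ^ ij.2 * w) := by
  have := isDomain hc
  have hprime := prime_of_norm hc hp hπ
  -- The exponent of `π` is determined: a larger one would make `π` divide `star π` or `w`, but `p`
  -- does not divide the norm of `w`.
  have hlt : ∀ i j i' j' : ℕ, i < i' → i + j = k → i' + j' = k → ∀ w w' : QuadOrder c,
      QuadraticAlgebra.norm w = m → π ^ i * star π ^ j * w ≠ π ^ i' * star π ^ j' * w' := by
    intro i j i' j' hii hij hij' w w' hw h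
    obtain ⟨d, rfl⟩ := Nat.exists_eq_add_of_lt hii
    have h' : π ^ i * (star π ^ j * w) = π ^ i * (π * (π ^ d * star π ^ j' * w')) := by
      rw [← mul_assoc, h]; ring
    have hd : π ∣ star π ^ j * w := ⟨_, mul_left_cancel₀ (pow_ne_zero _ hprime.ne_zero) h'⟩
    rcases hprime.dvd_or_dvd hd with h1 | h1
    · exact hns (hprime.dvd_of_dvd_pow h1)
    · have := norm_dvd h1
      rw [hπ, hw] at this
      exact hpm (by exact_mod_cast this)
  have hstar0 : star π ≠ 0 := fun h => hprime.ne_zero (by rw [← star_star π, h, star_zero])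
  rw [← sum_product' (antidiagonal k) (sphere hc m)
    (fun ij w => f (π ^ ij.1 * star π ^ ij.2 * w))]
  symm
  refine sum_nbij (fun x => π ^ x.1.1 * star π ^ x.1.2 * x.2) ?_ ?_ ?_ (fun _ _ => rfl)
  · rintro ⟨⟨i, j⟩, w⟩ hx
    simp only [mem_product, HasAntidiagonal.mem_antidiagonal, mem_sphere] at hx ⊢
    simp only [map_mul, map_pow, QuadraticAlgebra.norm_star, hπ, hx.2, ← hx.1]
    push_cast; ring
  · rintro ⟨⟨i, j⟩, w⟩ hx ⟨⟨i', j'⟩, w'⟩ hx' h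
    simp only [coe_product, Set.mem_prod, mem_coe, HasAntidiagonal.mem_antidiagonal,
      mem_sphere] at hx hx' h
    obtain rfl : i = i' := by
      rcases lt_trichotomy i i' with hl | hl | hl
      · exact absurd h (hlt _ _ _ _ hl hx.1 hx'.1 _ _ hx.2)
      · exact hl
      · exact absurd h.symm (hlt _ _ _ _ hl hx'.1 hx.1 _ _ hx'.2)
    obtain rfl : j = j' := by omega
    rw [mul_left_cancel₀ (mul_ne_zero (pow_ne_zero _ hprime.ne_zero) (pow_ne_zero _ hstar0)) h]
  · intro z hz
    rw [mem_coe, mem_sphere] at hz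
    obtain ⟨i, j, w, hij, hw, rfl⟩ := exists_eq_pow_mul_star_pow hc hp hπ k z hz
    exact ⟨⟨⟨i, j⟩, w⟩, by simp [hij, hw], rfl⟩

/-- Here `π ^ i * star π ^ j` depends on `i + j` only, up to sign. -/
theorem sum_sphere_ramified (hc : 0 < c) {p m : ℕ} (hp : p.Prime) {π : QuadOrder c}
    (hπ : QuadraticAlgebra.norm π = p) (hram : star π = -π) (k : ℕ) (f : QuadOrder c → K) :
    ∑ z ∈ sphere hc (p ^ k * m), f z = ∑ w ∈ sphere hc m, f (π ^ k * w) := by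
  refine sum_sphere_mul_of_dvd hc (pow_ne_zero k hp.ne_zero) (by rw [map_pow, hπ]; simp)
    (fun z hz => ?_) f
  obtain ⟨i, j, w, hij, -, rfl⟩ := exists_eq_pow_mul_star_pow hc hp hπ k z hz
  refine ⟨(-1) ^ j * w, ?_⟩
  rw [hram, ← hij, neg_pow]; ring

theorem dvd_of_inert_of_dvd_norm {p : ℕ} (hin : Prime (p : QuadOrder c)) {z : QuadOrder c} {n : ℕ}
    (hz : QuadraticAlgebra.norm z = n) (hpn : p ∣ n) : (p : QuadOrder c) ∣ z := by
  have h : (p : QuadOrder c) ∣ z * star z := by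
    rw [mul_star_eq_nat hz]; exact Nat.cast_dvd_cast hpn
  rcases hin.dvd_or_dvd h with h | h
  · exact h
  · rwa [dvd_star_iff, star_natCast] at h

theorem sum_sphere_inert_even (hc : 0 < c) {p m : ℕ} (hp : p.Prime)
    (hin : Prime (p : QuadOrder c)) (k : ℕ) (f : QuadOrder c → K) :
    ∑ z ∈ sphere hc (p ^ (2 * k) * m), f z =
      ∑ w ∈ sphere hc m, f ((p : QuadOrder c) ^ k * w) := by
  induction k generalizing f with
  | zero => simp
  | succ k ih =>
    have e : p ^ (2 * (k + 1)) * m = p ^ 2 * (p ^ (2 * k) * m) := by ring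
    rw [e, sum_sphere_mul_of_dvd hc (pow_ne_zero 2 hp.ne_zero) (α := (p : QuadOrder c))
      (by rw [QuadraticAlgebra.norm_natCast]; simp)
      (fun z hz => dvd_of_inert_of_dvd_norm hin hz
        ((dvd_pow_self p two_ne_zero).mul_right _)) f, ih]
    exact sum_congr rfl fun w _ => by ring_nf

/-- An inert `p` dividing a norm divides the element, so norms lose factors `p²`; at the end `p²`
would divide `p * m`. -/
theorem sphere_inert_odd (hc : 0 < c) {p m : ℕ} (hp : p.Prime) (hpm : ¬ p ∣ m)
    (hin : Prime (p : QuadOrder c)) (k : ℕ) : sphere hc (p ^ (2 * k + 1) * m) = ∅ := by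
  have hp0 : (p : ℤ) ≠ 0 := by exact_mod_cast hp.ne_zero
  rw [eq_empty_iff_forall_notMem]
  intro z hz
  rw [mem_sphere] at hz
  induction k generalizing z with
  | zero =>
    obtain ⟨w, rfl⟩ := dvd_of_inert_of_dvd_norm hin hz ((dvd_pow_self p (by omega)).mul_right _)
    rw [map_mul, QuadraticAlgebra.norm_natCast] at hz
    have : (p : ℤ) * QuadraticAlgebra.norm w = m := by
      apply mul_left_cancel₀ hp0
      push_cast at hz; linear_combination hz
    exact hpm (Int.natCast_dvd_natCast.1 ⟨_, this.symm⟩)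
  | succ k ih =>
    obtain ⟨w, rfl⟩ := dvd_of_inert_of_dvd_norm hin hz ((dvd_pow_self p (by omega)).mul_right _)
    refine ih w ?_
    rw [map_mul, QuadraticAlgebra.norm_natCast] at hz
    apply mul_left_cancel₀ (pow_ne_zero 2 hp0)
    rw [hz]; push_cast; ring

end sums

theorem eq_or_eq_neg_of_dvd (hc : 2 ≤ c) {z w : QuadOrder c} (hz : z ≠ 0)
    (hn : QuadraticAlgebra.norm z = QuadraticAlgebra.norm w) (h : z ∣ w) : w = z ∨ w = -z := by
  obtain ⟨u, rfl⟩ := h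
  have hz' : QuadraticAlgebra.norm z ≠ 0 := (norm_eq_zero (by omega)).not.2 hz
  have hu : QuadraticAlgebra.norm u = 1 := by
    apply mul_left_cancel₀ hz'
    rw [← map_mul, ← hn, mul_one]
  rcases (norm_eq_one_iff hc).1 hu with rfl | rfl
  · left; simp
  · right; simp

/-- A non-split prime norm is the norm of an anti-invariant element. -/
theorem star_eq_neg_of_dvd (hc : 2 ≤ c) {p : ℕ} (hp : p.Prime) {π : QuadOrder c}
    (hπ : QuadraticAlgebra.norm π = p) (h : π ∣ star π) : star π = -π := by
  have h0 : π ≠ 0 := by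
    rintro rfl
    rw [QuadraticAlgebra.norm_zero] at hπ
    exact hp.ne_zero (by exact_mod_cast hπ.symm)
  rcases eq_or_eq_neg_of_dvd hc h0 (QuadraticAlgebra.norm_star π).symm h with h | h
  -- A self-conjugate `π` is a rational integer, and `p` would be its square.
  · have him : π.im = 0 := by
      have := congrArg QuadraticAlgebra.im h
      rw [im_star] at this
      omega
    have : π.re ^ 2 = p := by rw [← hπ, norm_eq, him]; ring
    exact absurd (Nat.prime_iff_prime_int.1 hp) (by rw [← this]; exact not_prime_pow (by norm_num))
  · exact h

/-- The norm form `x² + (4c - 1) y²` on the elements with even second coordinate. -/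
theorem norm_mk_even (x y : ℤ) : QuadraticAlgebra.norm (⟨x - y, 2 * y⟩ : QuadOrder c)
    = x ^ 2 + (4 * c - 1) * y ^ 2 := by
  rw [norm_eq]; ring

end QuadOrder

/-- The character sum over `i + j = k` of `χ(π)^i χ(π̄)^j` when `χ(π)` is a primitive cube root of
unity. -/
theorem sum_antidiagonal_cube_root {K : Type*} [Field K] {w : K} (hw : w ^ 2 + w + 1 = 0) (k : ℕ) :
    ∑ ij ∈ antidiagonal k, w ^ ij.1 * (w ^ 2) ^ ij.2 = (jacobiSym (k + 1 : ℕ) 3 : K) := by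
  have hw3 : w ^ 3 = 1 := by linear_combination (w - 1) * hw
  -- By this recursion the sums run periodically through `1`, `w + w² = -1`, `0`.
  have hstep : ∀ k : ℕ, ∑ ij ∈ antidiagonal (k + 1), w ^ ij.1 * (w ^ 2) ^ ij.2
      = (w ^ 2) ^ (k + 1) + w * ∑ ij ∈ antidiagonal k, w ^ ij.1 * (w ^ 2) ^ ij.2 := fun k => by
    rw [Nat.sum_antidiagonal_succ, mul_sum]
    simp only [pow_zero, one_mul, pow_succ w]
    congr 1
    exact sum_congr rfl fun _ _ => by ring
  have h3m : ∀ m : ℕ, (w ^ 2) ^ (3 * m) = 1 := fun m => by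
    rw [← pow_mul, show 2 * (3 * m) = 3 * (2 * m) by ring, pow_mul, hw3, one_pow]
  have hmain : ∀ m : ℕ, ∑ ij ∈ antidiagonal (3 * m), w ^ ij.1 * (w ^ 2) ^ ij.2 = 1 := fun m => by
    induction m with
    | zero => simp
    | succ m ih =>
      rw [show 3 * (m + 1) = 3 * m + 1 + 1 + 1 by ring, hstep, hstep, hstep, ih]
      simp only [pow_succ _ (3 * m + 1 + 1), pow_succ _ (3 * m + 1), pow_succ _ (3 * m), h3m]
      linear_combination (w ^ 4 + w - 1) * hw
  have hJ : ∀ m r : ℕ, jacobiSym ((3 * m + r + 1 : ℕ) : ℤ) 3 = jacobiSym ((r + 1 : ℕ) : ℤ) 3 :=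
    fun m r => by
      rw [jacobiSym.mod_left, jacobiSym.mod_left ((r + 1 : ℕ) : ℤ)]
      congr 1
      push_cast
      omega
  obtain ⟨m, r, hr, rfl⟩ : ∃ m r : ℕ, r < 3 ∧ k = 3 * m + r :=
    ⟨k / 3, k % 3, Nat.mod_lt _ (by norm_num), (Nat.div_add_mod k 3).symm⟩
  rw [hJ]
  interval_cases r
  · rw [add_zero, hmain]
    have : jacobiSym ((0 + 1 : ℕ) : ℤ) 3 = 1 := by norm_num
    rw [this]; simp
  · rw [hstep, hmain, pow_succ, h3m]
    have : jacobiSym ((1 + 1 : ℕ) : ℤ) 3 = -1 := by norm_num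
    rw [this]; push_cast; linear_combination hw
  · rw [show 3 * m + 2 = 3 * m + 1 + 1 by ring, hstep, hstep, hmain, pow_succ, pow_succ, h3m]
    have : jacobiSym ((2 + 1 : ℕ) : ℤ) 3 = 0 := by norm_num
    rw [this]; push_cast; linear_combination (w ^ 2) * hw

end NormRep

/-! ### The primes of `n_q` and the evaluation of the character sum -/

namespace NormRep

open QuadraticAlgebra Finset

theorem isSquare_of_norm_eq {a : ℕ} {c : ℤ} (h : (a : ℤ) = 4 * c - 1) (hap : a.Prime) {p : ℕ}
    {z : QuadOrder c} (hz : QuadraticAlgebra.norm z = p) : IsSquare (p : ZMod a) := by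
  have := Fact.mk hap
  have h2 : (2 : ZMod a) ≠ 0 := by
    intro h0
    have : ((2 : ℕ) : ZMod a) = 0 := by exact_mod_cast h0
    rw [ZMod.natCast_eq_zero_iff] at this
    have := (Nat.prime_dvd_prime_iff_eq hap Nat.prime_two).1 this
    omega
  have h4 := QuadOrder.four_mul_norm z
  rw [hz, ← h] at h4
  have h5 := congrArg (Int.cast : ℤ → ZMod a) h4
  push_cast at h5
  rw [ZMod.natCast_self, zero_mul, add_zero] at h5
  refine ⟨(2 * z.re + z.im) / 2, ?_⟩
  field_simp
  linear_combination h5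

/-- A prime norm from `QuadOrder c` is represented by `x² + a y²` exactly when its generator lies in
the suborder `ℤ[√-a]`. -/
theorem isQPrime_iff_of_norm {a : ℕ} {c : ℤ} (h : (a : ℤ) = 4 * c - 1) (hc : 2 ≤ c)
    (hap : a.Prime) {p : ℕ} (hp : p.Prime) {π : QuadOrder c} (hπ : QuadraticAlgebra.norm π = p) :
    IsQPrime a p ↔ ¬ Even π.im := by
  have hprime := QuadOrder.prime_of_norm (by omega) hp hπ
  constructor
  · rintro ⟨-, hno⟩ ⟨y, hy⟩
    refine hno ⟨π.re + y, y, ?_⟩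
    rw [← hπ, QuadOrder.norm_eq, hy, h]; ring
  · intro him
    refine ⟨isSquare_of_norm_eq h hap hπ, ?_⟩
    rintro ⟨x, y, hxy⟩
    have hw : QuadraticAlgebra.norm (⟨x - y, 2 * y⟩ : QuadOrder c) = p := by
      rw [QuadOrder.norm_mk_even, ← h, hxy]
    have hdvd : π ∣ (⟨x - y, 2 * y⟩ : QuadOrder c) * star ⟨x - y, 2 * y⟩ := by
      rw [QuadOrder.mul_star_eq_nat hw, ← QuadOrder.mul_star_eq_nat hπ]
      exact dvd_mul_right _ _
    -- Multiples of `π` of norm `p` are `±π`, so a representation of `p` by `x² + a y²` would make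
    -- `π.im` even.
    have key : ∀ w : QuadOrder c, QuadraticAlgebra.norm w = p → Even w.im → ¬ π ∣ w := by
      intro w hw hwe hdvd
      rcases QuadOrder.eq_or_eq_neg_of_dvd hc hprime.ne_zero (hπ.trans hw.symm) hdvd with rfl | rfl
      · exact him hwe
      · exact him (by simpa using hwe)
    rcases hprime.dvd_or_dvd hdvd with hd | hd
    · exact key _ hw (even_two_mul y) hd
    · exact key _ (by rw [QuadraticAlgebra.norm_star, hw]) (by simp) hd

/-- For `a ≡ 3` modulo 4, quadratic reciprocity reads `(-a | p) = (p | a)`. -/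
theorem legendreSym_neg_eq_one {a p : ℕ} [Fact a.Prime] [Fact p.Prime] (ha : a % 4 = 3)
    (hp2 : p ≠ 2) (hpa : p ≠ a) (hsq : IsSquare (p : ZMod a)) :
    legendreSym p (-(a : ℤ)) = 1 := by
  have ha0 : ((p : ℤ) : ZMod a) ≠ 0 := by
    rw [Int.cast_natCast, Ne, ZMod.natCast_eq_zero_iff,
      Nat.prime_dvd_prime_iff_eq Fact.out Fact.out]
    exact hpa.symm
  have h1 : legendreSym a p = 1 := by
    rw [legendreSym.eq_one_iff a ha0, Int.cast_natCast]
    exact hsq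
  have hodd : p % 2 = 1 := (Fact.out : p.Prime).eq_two_or_odd.resolve_left hp2
  rw [neg_eq_neg_one_mul, legendreSym.mul, legendreSym.at_neg_one hp2]
  rcases (by omega : p % 4 = 1 ∨ p % 4 = 3) with h4 | h4
  · rw [ZMod.χ₄_nat_one_mod_four h4,
      ← legendreSym.quadratic_reciprocity_one_mod_four h4 (by omega), h1, one_mul]
  · rw [ZMod.χ₄_nat_three_mod_four h4,
      legendreSym.quadratic_reciprocity_three_mod_four ha h4, h1]
    norm_num

/-- Were `p` a residue, `-a` would be a square modulo `p`, and `p` would divide the norm of some `x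
+ √-a = (x - 1) + 2ω`, hence the coefficient 2. The prime `p = a` is excluded as `0² + a * 1²`. -/
theorem not_isQPrime_of_inert {a : ℕ} {c : ℤ} (h : (a : ℤ) = 4 * c - 1) (hap : a.Prime) {p : ℕ}
    (hp : p.Prime) (hp2 : p ≠ 2) (hin : Prime (p : QuadOrder c)) : ¬ IsQPrime a p := by
  rintro ⟨hsq, hno⟩
  have hpa : p ≠ a := by
    rintro rfl
    exact hno ⟨0, 1, by ring⟩
  have := Fact.mk hap
  have := Fact.mk hp
  have hleg := legendreSym_neg_eq_one (by omega) hp2 hpa hsq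
  have h0 : ((-(a : ℤ) : ℤ) : ZMod p) ≠ 0 := by
    intro h0
    rw [(legendreSym.eq_zero_iff p _).2 h0] at hleg
    exact zero_ne_one hleg
  obtain ⟨x, hx⟩ := (legendreSym.eq_one_iff p h0).1 hleg
  obtain ⟨x, rfl⟩ := ZMod.intCast_surjective x
  have hdvd : (p : ℤ) ∣ x ^ 2 + a := by
    rw [← ZMod.intCast_zmod_eq_zero_iff_dvd]
    push_cast at hx ⊢
    linear_combination -hx
  have hN : QuadraticAlgebra.norm (⟨x - 1, 2 * 1⟩ : QuadOrder c) = ((x ^ 2 + a).toNat : ℕ) := by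
    rw [QuadOrder.norm_mk_even, ← h, Int.toNat_of_nonneg (by positivity)]; ring
  have h2 := (QuadOrder.natCast_dvd.1 (QuadOrder.dvd_of_inert_of_dvd_norm hin hN
    (by rw [← Int.natCast_dvd_natCast, Int.toNat_of_nonneg (by positivity)]; exact hdvd))).2
  have h3 : (p : ℤ) ∣ (2 : ℕ) := h2
  exact hp2 ((Nat.prime_dvd_prime_iff_eq hp Nat.prime_two).1
    (Int.natCast_dvd_natCast.1 h3))

section qPart

variable {a : ℕ}

theorem qPart_one : qPart 1 a = 1 := by simp [qPart]

theorem not_dvd_qPart {p m : ℕ} (hp : p.Prime) (hpm : ¬ p ∣ m) : ¬ p ∣ qPart m a := by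
  classical
  intro h
  rw [qPart, hp.prime.dvd_finsetProd_iff] at h
  obtain ⟨q, hq, hpq⟩ := h
  rw [mem_filter, Nat.mem_primeFactors] at hq
  rw [(Nat.prime_dvd_prime_iff_eq hp hq.1.1).1 (hp.dvd_of_dvd_pow hpq)] at hpm
  exact hpm hq.1.2.1

theorem qPart_ne_zero (n : ℕ) : qPart n a ≠ 0 := by
  classical
  rw [qPart, prod_ne_zero_iff]
  intro p hp
  rw [mem_filter] at hp
  exact pow_ne_zero _ (Nat.prime_of_mem_primeFactors hp.1).ne_zero

open Classical in
theorem qPart_prime_pow_mul {p k m : ℕ} (hp : p.Prime) (hk : k ≠ 0) (hpm : ¬ p ∣ m) :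
    qPart (p ^ k * m) a = (if IsQPrime a p then p ^ k else 1) * qPart m a := by
  have hm : m ≠ 0 := by rintro rfl; exact hpm (dvd_zero p)
  have hpf : (p ^ k * m).primeFactors = insert p m.primeFactors := by
    rw [Nat.primeFactors_mul (pow_ne_zero k hp.ne_zero) hm, Nat.primeFactors_prime_pow hk hp]
    rfl
  have hfac : ∀ q, (p ^ k * m).factorization q
      = (if p = q then k else 0) + m.factorization q := fun q => by
    rw [Nat.factorization_mul (pow_ne_zero k hp.ne_zero) hm, Nat.Prime.factorization_pow hp,
      Finsupp.add_apply, Finsupp.single_apply]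
  have hpnot : p ∉ m.primeFactors := fun h => hpm (Nat.dvd_of_mem_primeFactors h)
  have hrest : ∏ q ∈ m.primeFactors with IsQPrime a q, q ^ (p ^ k * m).factorization q
      = qPart m a := by
    rw [qPart]
    refine prod_congr rfl fun q hq => ?_
    have : p ≠ q := by
      rintro rfl
      exact hpnot (mem_filter.1 hq).1
    rw [hfac, if_neg this, zero_add]
  rw [qPart, hpf, filter_insert]
  split_ifs with hQ
  · rw [prod_insert (fun h => hpnot (mem_filter.1 h).1), hrest, hfac, if_pos rfl,
      Nat.factorization_eq_zero_of_not_dvd hpm, add_zero]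
  · rw [hrest, one_mul]

theorem tau_prime_pow_mul {p k m : ℕ} (hp : p.Prime) (hpm : ¬ p ∣ m) :
    tau (p ^ k * m) = (k + 1) * tau m := by
  rw [tau, Nat.Coprime.card_divisors_mul (((Nat.Prime.coprime_iff_not_dvd hp).2 hpm).pow_left k),
    Nat.divisors_prime_pow hp, card_map, card_range, tau]

end qPart

/-- The sum of the cubic character modulo `2` over the elements of odd norm `n`. -/
theorem sum_chi_mul_tau {K : Type*} [Field K] {ζ : K} (hζ : ζ ^ 2 + ζ + 1 = 0) {a : ℕ} {c : ℤ}
    (h : (a : ℤ) = 4 * c - 1) (hc : 2 ≤ c) (hodd : Odd c) (hap : a.Prime) (hin : InertOrNorm c)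
    (hc0 : 0 < c) (n : ℕ) (hn : Odd n) :
    (∑ z ∈ QuadOrder.sphere hc0 n, QuadOrder.chi ζ z) * (tau (qPart n a) : K)
      = (jacobiSym (tau (qPart n a)) 3 : K) * ((QuadOrder.sphere hc0 n).card : K) := by
  have hζ3 : ζ ^ 3 = 1 := by linear_combination (ζ - 1) * hζ
  have hcard : ∀ m, ((QuadOrder.sphere hc0 m).card : K) = ∑ z ∈ QuadOrder.sphere hc0 m, (1 : K) :=
    fun m => by simp
  -- The cross-multiplied identity is compatible with each prime power, and it survives when no
  -- element has norm `n`.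
  induction n using Nat.recOnPrimePow with
  | zero => exact absurd hn (by decide)
  | one =>
    have htau : tau 1 = 1 := by simp [tau]
    rw [qPart_one, htau]
    have h1 : jacobiSym ((1 : ℕ) : ℤ) 3 = 1 := by norm_num
    rw [h1, hcard, Nat.cast_one, Int.cast_one, mul_one, one_mul]
    refine sum_congr rfl fun z hz => ?_
    rw [QuadOrder.mem_sphere, Nat.cast_one, QuadOrder.norm_eq_one_iff hc] at hz
    rcases hz with rfl | rfl <;> simp [QuadOrder.chi, re_one, im_one]
  | prime_pow_mul m p k hp hpm hk ih =>
    have hoddm := (Nat.odd_mul.1 hn).2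
    have hoddp : Odd p := (Nat.odd_pow_iff hk.ne').1 (Nat.odd_mul.1 hn).1
    have hp2 : p ≠ 2 := by rintro rfl; exact absurd hoddp (by decide)
    have ih := ih hoddm
    have hq := qPart_prime_pow_mul (a := a) hp hk.ne' hpm
    rcases hin p hp with hinert | ⟨π, hπ⟩
    · rw [if_neg (not_isQPrime_of_inert h hap hp hp2 hinert), one_mul] at hq
      rw [hq]
      rcases Nat.even_or_odd' k with ⟨j, rfl | rfl⟩
      · have hchip : QuadOrder.chi ζ (p : QuadOrder c) = 1 :=
          QuadOrder.chi_eq_one_of_even hodd (hoddp.pow (n := 2))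
            (by rw [QuadraticAlgebra.norm_natCast]; simp) (by simp)
        rw [hcard, QuadOrder.sum_sphere_inert_even hc0 hp hinert,
          QuadOrder.sum_sphere_inert_even hc0 hp hinert, ← hcard]
        simpa [QuadOrder.chi_mul hodd hζ3, QuadOrder.chi_pow hodd hζ3, hchip] using ih
      · rw [QuadOrder.sphere_inert_odd hc0 hp hpm hinert]
        simp
    · have hqiff := isQPrime_iff_of_norm h hc hap hp hπ
      by_cases hdvd : π ∣ star π
      · have hstar := QuadOrder.star_eq_neg_of_dvd hc hp hπ hdvd
        -- `star π = -π` means `π.im = -2 * π.re`.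
        have him : Even π.im := by
          have := congrArg QuadraticAlgebra.re hstar
          rw [re_star, re_neg, one_mul] at this
          exact ⟨-π.re, by linarith⟩
        rw [if_neg (fun hQ => hqiff.1 hQ him), one_mul] at hq
        have hchip := QuadOrder.chi_eq_one_of_even (ζ := ζ) hodd hoddp hπ him
        rw [hq, hcard, QuadOrder.sum_sphere_ramified hc0 hp hπ hstar,
          QuadOrder.sum_sphere_ramified hc0 hp hπ hstar, ← hcard]
        simpa [QuadOrder.chi_mul hodd hζ3, QuadOrder.chi_pow hodd hζ3, hchip] using ih
      · have hB : ((QuadOrder.sphere hc0 (p ^ k * m)).card : K)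
            = (k + 1 : ℕ) * ((QuadOrder.sphere hc0 m).card : K) := by
          rw [hcard, QuadOrder.sum_sphere_split hc0 hp hpm hπ hdvd]
          simp
        have hS : ∑ z ∈ QuadOrder.sphere hc0 (p ^ k * m), QuadOrder.chi ζ z
            = (∑ ij ∈ antidiagonal k, QuadOrder.chi ζ π ^ ij.1 * (QuadOrder.chi ζ π ^ 2) ^ ij.2) *
              ∑ z ∈ QuadOrder.sphere hc0 m, QuadOrder.chi ζ z := by
          rw [QuadOrder.sum_sphere_split hc0 hp hpm hπ hdvd, sum_mul_sum]
          simp only [QuadOrder.chi_mul hodd hζ3, QuadOrder.chi_pow hodd hζ3,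
            QuadOrder.chi_star hζ3]
        rw [hS, hB]
        by_cases him : Even π.im
        · rw [if_neg (fun hQ => hqiff.1 hQ him), one_mul] at hq
          rw [hq, QuadOrder.chi_eq_one_of_even (ζ := ζ) hodd hoddp hπ him]
          simp only [one_pow, mul_one, sum_const, Nat.card_antidiagonal, nsmul_eq_mul]
          linear_combination ((k + 1 : ℕ) : K) * ih
        · rw [if_pos (hqiff.2 him)] at hq
          rw [hq, tau_prime_pow_mul hp (not_dvd_qPart hp hpm),
            sum_antidiagonal_cube_root (QuadOrder.chi_sq_add_chi_add_one hζ him), Nat.cast_mul,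
            Nat.cast_mul, jacobiSym.mul_left, Int.cast_mul]
          linear_combination ((k + 1 : ℕ) : K) * (jacobiSym ((k + 1 : ℕ) : ℤ) 3 : K) * ih

/-- Orthogonality: the elements of odd norm lying in `ℤ[√-a]` are detected by the cubic character. -/
theorem three_mul_card_even {K : Type*} [Field K] {ζ : K} (hζ : ζ ^ 2 + ζ + 1 = 0) {c : ℤ}
    (hodd : Odd c) (hc : 0 < c) {n : ℕ} (hn : Odd n) :
    3 * (((QuadOrder.sphere hc n).filter (fun z => Even z.im)).card : K)
      = ((QuadOrder.sphere hc n).card : K) + 2 * ∑ z ∈ QuadOrder.sphere hc n, QuadOrder.chi ζ z := by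
  have hζ3 : ζ ^ 3 = 1 := by linear_combination (ζ - 1) * hζ
  -- Conjugation permutes the elements of norm `n` and squares the character.
  have hstar : ∑ z ∈ QuadOrder.sphere hc n, QuadOrder.chi ζ z ^ 2
      = ∑ z ∈ QuadOrder.sphere hc n, QuadOrder.chi ζ z := by
    refine sum_nbij' star star ?_ ?_ (fun z _ => star_star z) (fun z _ => star_star z)
      (fun z _ => (QuadOrder.chi_star hζ3 z).symm)
    all_goals
      intro z hz
      rwa [QuadOrder.mem_sphere, QuadraticAlgebra.norm_star, ← QuadOrder.mem_sphere hc]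
  have hpt : ∀ z ∈ QuadOrder.sphere hc n, (3 : K) * (if Even z.im then 1 else 0)
      = 1 + QuadOrder.chi ζ z + QuadOrder.chi ζ z ^ 2 := by
    intro z hz
    rw [QuadOrder.mem_sphere] at hz
    split_ifs with him
    · rw [QuadOrder.chi_eq_one_of_even hodd hn hz him]; norm_num
    · linear_combination -(QuadOrder.chi_sq_add_chi_add_one hζ him)
  rw [card_filter, Nat.cast_sum, mul_sum]
  simp only [Nat.cast_ite, Nat.cast_one, Nat.cast_zero]
  rw [sum_congr rfl hpt, sum_add_distrib, sum_add_distrib, hstar]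
  simp; ring

/-! ### Transfer of `X` and `Y` to `ℤ[ω]` -/

section counting

variable {a : ℕ} {c : ℤ}

/-- `x + y√-a = (x - y) + 2yω`. -/
theorem X_image (h : (a : ℤ) = 4 * c - 1) (hc : 0 < c) (n : ℕ) :
    (fun q : ℤ × ℤ => (⟨q.1 - q.2, 2 * q.2⟩ : QuadOrder c)) '' X n a
      = ((QuadOrder.sphere hc n).filter (fun z => Even z.im) : Finset (QuadOrder c)) := by
  ext z
  rw [mem_coe, mem_filter, QuadOrder.mem_sphere]
  constructor
  · rintro ⟨⟨x, y⟩, hxy, rfl⟩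
    refine ⟨?_, even_two_mul y⟩
    rw [QuadOrder.norm_mk_even, ← h]
    exact hxy
  · rintro ⟨hz, y, hy⟩
    have e : (⟨z.re + y - y, 2 * y⟩ : QuadOrder c) = z := by
      ext
      · simp
      · simp only; omega
    refine ⟨(z.re + y, y), ?_, e⟩
    rw [← e, QuadOrder.norm_mk_even, ← h] at hz
    exact hz

theorem X_embedding_injective :
    Function.Injective (fun q : ℤ × ℤ => (⟨q.1 - q.2, 2 * q.2⟩ : QuadOrder c)) := by
  rintro ⟨x, y⟩ ⟨x', y'⟩ hq
  simp only [QuadraticAlgebra.mk.injEq] at hq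
  ext <;> simp only <;> omega

theorem Y_eq_image (h : (a : ℤ) = 4 * c - 1) (hc : 0 < c) (ha : Squarefree a) (n : ℕ) :
    Y n a = quadEquiv h ha '' (QuadOrder.sphere hc n : Set (QuadOrder c)) := by
  ext z
  obtain ⟨w, rfl⟩ := (quadEquiv h ha).surjective z
  rw [(quadEquiv h ha).injective.mem_set_image, mem_coe, QuadOrder.mem_sphere]
  change QuadraticAlgebra.norm ((quadEquiv h ha w : ringOfInt a) : QSqrt a) = (n : ℚ) ↔ _
  rw [coe_quadEquiv, norm_quadEmb]
  exact_mod_cast Iff.rfl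

end counting

end NormRep

/-! ### The main theorem -/

theorem theorem3p5 :
    (∀ a ∈ ({11, 19, 43, 67, 163} : Finset ℕ), NormRep.IsHeegner a) ∧
    ∀ (a : ℕ), NormRep.IsHeegner a → 11 ≤ a → ∀ (n : ℕ),
      (NormRep.X n a).Finite ∧ (NormRep.Y n a).Finite ∧
      (Even n → (NormRep.X n a).ncard = (NormRep.Y n a).ncard) ∧
      (Odd n →
        ((NormRep.X n a).ncard : ℚ) =
          (1 / 3 : ℚ) *
            (1 + 2 * ((jacobiSym (NormRep.tau (NormRep.qPart n a) : ℤ) 3 : ℚ) /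
              (NormRep.tau (NormRep.qPart n a) : ℚ))) *
            ((NormRep.Y n a).ncard : ℚ)) := by
  refine ⟨fun a ha => NormRep.isHeegner_of_mem ha, fun a ha h11 n => ?_⟩
  have h8 := ha.mod_eight h11
  have hap := ha.prime h11
  obtain ⟨c, h⟩ : ∃ c : ℤ, (a : ℤ) = 4 * c - 1 := ⟨(a + 1) / 4, by omega⟩
  have hodd : Odd c := Int.odd_iff.2 (by omega)
  have hc : 0 < c := by omega
  have hX := NormRep.X_image h hc n
  have hY := NormRep.Y_eq_image h hc ha.1 n
  have hXcard : (NormRep.X n a).ncard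
      = ((NormRep.QuadOrder.sphere hc n).filter (fun z => Even z.im)).card := by
    rw [← Set.ncard_image_of_injective _ (NormRep.X_embedding_injective (c := c)), hX,
      Set.ncard_coe_finset]
  have hYcard : (NormRep.Y n a).ncard = (NormRep.QuadOrder.sphere hc n).card := by
    rw [hY, Set.ncard_image_of_injective _ (NormRep.quadEquiv h ha.1).injective,
      Set.ncard_coe_finset]
  refine ⟨?_, ?_, fun hn => ?_, fun hn => ?_⟩
  · refine Set.Finite.of_finite_image ?_ (NormRep.X_embedding_injective (c := c)).injOn
    rw [hX]
    exact Finset.finite_toSet _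
  · rw [hY]
    exact (Finset.finite_toSet _).image _
  · rw [hXcard, hYcard, Finset.filter_true_of_mem]
    intro z hz
    rw [NormRep.QuadOrder.mem_sphere] at hz
    exact ((NormRep.QuadOrder.even_norm_iff hodd).1 (by rw [hz]; exact_mod_cast hn)).2
  -- The character takes complex values, but the final identity involves only integers and descends
  -- to `ℚ`.
  · obtain ⟨ζ, hζ⟩ : ∃ ζ : ℂ, ζ ^ 2 + ζ + 1 = 0 := by
      obtain ⟨ζ, hζ⟩ := IsAlgClosed.exists_root
        (Polynomial.X ^ 2 + Polynomial.X + 1 : Polynomial ℂ) (by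
          have : (Polynomial.X ^ 2 + Polynomial.X + 1 : Polynomial ℂ).degree = 2 := by
            compute_degree!
          rw [this]; norm_num)
      exact ⟨ζ, by simpa [Polynomial.IsRoot] using hζ⟩
    have h1 := NormRep.three_mul_card_even hζ hodd hc hn
    have h2 := NormRep.sum_chi_mul_tau hζ h (by omega) hodd hap (ha.inertOrNorm h hc) hc n hn
    rw [← hXcard, ← hYcard] at h1
    rw [← hYcard] at h2
    have htau : (NormRep.tau (NormRep.qPart n a) : ℚ) ≠ 0 := by
      rw [NormRep.tau, Nat.cast_ne_zero, Finset.card_ne_zero, Nat.nonempty_divisors]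
      exact NormRep.qPart_ne_zero n
    have h3 : (3 * ((NormRep.X n a).ncard : ℂ)) * (NormRep.tau (NormRep.qPart n a) : ℂ)
        = ((NormRep.Y n a).ncard : ℂ) * (NormRep.tau (NormRep.qPart n a) : ℂ)
          + 2 * ((jacobiSym (NormRep.tau (NormRep.qPart n a) : ℤ) 3 : ℂ)
            * ((NormRep.Y n a).ncard : ℂ)) := by
      linear_combination (NormRep.tau (NormRep.qPart n a) : ℂ) * h1 + 2 * h2
    have h4 : (3 * ((NormRep.X n a).ncard : ℚ)) * (NormRep.tau (NormRep.qPart n a) : ℚ)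
        = ((NormRep.Y n a).ncard : ℚ) * (NormRep.tau (NormRep.qPart n a) : ℚ)
          + 2 * ((jacobiSym (NormRep.tau (NormRep.qPart n a) : ℤ) 3 : ℚ)
            * ((NormRep.Y n a).ncard : ℚ)) := by
      exact_mod_cast h3
    field_simp
    linear_combination h4
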